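/- All Banach spaces are real. For $n\in\mathbb N$ let $\mathrm{BM}_n$ be the set of linear isometry classes of norms on $\mathbb R^n$, metrized by the Banach–Mazur distance $d_{\mathrm{BM}}(E,F)=\inf\{\log(\|T\|\,\|T^{-1}\|) : T\colon E\to F \text{ a linear isomorphism}\}$ (equal to $0$ when $n=0$), and let $\mathrm{BM}=\bigsqcup_{n\in\mathbb N}\mathrm{BM}_n$ with the disjoint union topology; elements of $\mathrm{BM}$ are identified with finite-dimensional normed spaces. For normed spaces $E,F$ let $\mathrm{Emb}(E,F)$ be the set of linear isometric embeddings $E\to F$ and, for $C\ge 0$, let $\mathrm{Emb}_C(E,F)$ be the set of bounded linear operators $T\colon E\to F$ with $e^{-C}\|x\|\le\|Tx\|\le e^{C}\|x\|$ for all $x\in E$. For a separable Banach space $X$, $\mathrm{Age}(X)\subseteq\mathrm{BM}$ is the set of finite-dimensional normed spaces isometric to a subspace of $X$, and $\overline{\mathrm{Age}(X)}$ is its closure in $\mathrm{BM}$. A set $\mathcal K\subseteq \mathrm{BM}$ * has the **$\omega$-amalgamation property** if for every $E\in\mathcal K$, $C>0$, $\varepsilon>0$ and all sequences $(F_n)_{n\in\mathbb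 N}$ in $\mathcal K$ and $f_n\in\mathrm{Emb}_C(E,F_n)$ there are $m\ne n$, $G\in\mathcal K$, $g_m\in\mathrm{Emb}(F_m,G)$ and $g_n\in\mathrm{Emb}(F_n,G)$ with $\|g_m\circ f_m-g_n\circ f_n\|<\varepsilon$; * is a **guarded Fraïssé class** if it is nonempty, closed in $\mathrm{BM}$, and satisfies the following three properties. * (HP) If $F\in\mathcal K$ and $E\in\mathrm{BM}$ embeds isometrically into $F$, then $E\in\mathcal K$. * (JEP) For all $F,G\in\mathcal K$ there is $H\in\mathcal K$ into which both $F$ and $G$ embed isometrically. * (GAP) For every $E\in\mathcal K$ and $\varepsilon>0$ there are $F\in\mathcal K$, $\phi\in\mathrm{Emb}_\varepsilon(E,F)$ and $\delta>0$ such that for all $G,H\in\mathcal K$, $\psi_G\in\mathrm{Emb}_\delta(F,G)$ and $\psi_H\in\mathrm{Emb}_\delta(F,H)$ there are $K\in\mathcal K$, $\iota_G\in\mathrm{Emb}(G,K)$ and $\iota_H\in\mathrm{Emb}(H,K)$ with $\|\iota_G\circ\psi_G\circ\phi-\iota_H\circ\psi_H\circ\phi\|<\varepsilon$. A Banach space $Y$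 is **finitely representable** in $X$ if $\mathrm{Emb}_\varepsilon(E,X)\neq\varnothing$ for every finite-dimensional subspace $E\subseteq Y$ and every $\varepsilon>0$. A separable Banach space $X$ is **relatively universal** if every separable Banach space that is finitely representable in $X$ embeds linearly isometrically into $X$. **Theorem.** Let $X$ be a separable Banach space such that at least one of the following conditions holds: 1. $\overline{\mathrm{Age}(X)}$ has the $\omega$-amalgamation property; 2. $X$ is relatively universal. Then $\overline{\mathrm{Age}(X)}$ is a guarded Fraïssé class. -/

import Mathlib

noncomputable section

namespace GuardedFraisse

open Topology

/-- A norm on the real vector space `ℝⁿ`. -/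
structure NormOn (n : ℕ) where
  toSeminorm : Seminorm ℝ (Fin n → ℝ)
  eq_zero_of_map_eq_zero : ∀ x, toSeminorm x = 0 → x = 0

/-- The vector space `ℝⁿ`, normed by `μ`. -/
def NormOn.Space {n : ℕ} (_μ : NormOn n) : Type := Fin n → ℝ

namespace NormOn

variable {n : ℕ}

instance (μ : NormOn n) : AddCommGroup μ.Space := inferInstanceAs (AddCommGroup (Fin n → ℝ))

instance (μ : NormOn n) : Module ℝ μ.Space := inferInstanceAs (Module ℝ (Fin n → ℝ))

instance (μ : NormOn n) : FiniteDimensional ℝ μ.Space :=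
  inferInstanceAs (FiniteDimensional ℝ (Fin n → ℝ))

instance (μ : NormOn n) : NormedAddCommGroup μ.Space :=
  AddGroupNorm.toNormedAddCommGroup
    { toFun := fun x : μ.Space => μ.toSeminorm x
      map_zero' := map_zero μ.toSeminorm
      add_le' := map_add_le_add μ.toSeminorm
      neg' := map_neg_eq_map μ.toSeminorm
      eq_zero_of_map_eq_zero' := μ.eq_zero_of_map_eq_zero }

instance (μ : NormOn n) : NormedSpace ℝ μ.Space where
  norm_smul_le a x := (map_smul_eq_mul μ.toSeminorm a x).le

theorem finrank_space (μ : NormOn n) : Module.finrank ℝ μ.Space = n :=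
  Module.finrank_fin_fun ℝ

instance (μ ν : NormOn n) : Nonempty (μ.Space ≃L[ℝ] ν.Space) :=
  ⟨ContinuousLinearEquiv.ofFinrankEq (by rw [finrank_space, finrank_space])⟩

/-- The logarithm of the distortion of an isomorphism. -/
def logDistortion {μ ν : NormOn n} (T : μ.Space ≃L[ℝ] ν.Space) : ℝ :=
  Real.log (‖(T : μ.Space →L[ℝ] ν.Space)‖ * ‖(T.symm : ν.Space →L[ℝ] μ.Space)‖)

/-- The Banach–Mazur pseudodistance
`inf {log (‖T‖ * ‖T⁻¹‖) : T an isomorphism}` between two norms on `ℝⁿ`. -/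
def distBM (μ ν : NormOn n) : ℝ :=
  ⨅ T : μ.Space ≃L[ℝ] ν.Space, logDistortion T

theorem distortion_cases {μ ν : NormOn n} (T : μ.Space ≃L[ℝ] ν.Space) :
    Subsingleton μ.Space ∨
      1 ≤ ‖(T : μ.Space →L[ℝ] ν.Space)‖ * ‖(T.symm : ν.Space →L[ℝ] μ.Space)‖ := by
  rcases T.subsingleton_or_norm_symm_pos with h | h
  · exact Or.inl h
  · right
    rcases subsingleton_or_nontrivial μ.Space with h' | h'
    · exfalso
      have : (T.symm : ν.Space →L[ℝ] μ.Space) = 0 := by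
        ext x; exact Subsingleton.elim _ _
      rw [this, norm_zero] at h
      exact lt_irrefl _ h
    · exact T.one_le_norm_mul_norm_symm

theorem logDistortion_of_subsingleton {μ ν : NormOn n} (T : μ.Space ≃L[ℝ] ν.Space)
    (h : Subsingleton μ.Space) : logDistortion T = 0 := by
  have : (T.symm : ν.Space →L[ℝ] μ.Space) = 0 := by
    ext x; exact Subsingleton.elim _ _
  rw [logDistortion, this, norm_zero, mul_zero, Real.log_zero]

theorem logDistortion_nonneg {μ ν : NormOn n} (T : μ.Space ≃L[ℝ] ν.Space) :
    0 ≤ logDistortion T := by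
  rcases distortion_cases T with h | h
  · exact (logDistortion_of_subsingleton T h).ge
  · exact Real.log_nonneg h

theorem bddBelow_logDistortion (μ ν : NormOn n) :
    BddBelow (Set.range fun T : μ.Space ≃L[ℝ] ν.Space => logDistortion T) :=
  ⟨0, by rintro _ ⟨T, rfl⟩; exact logDistortion_nonneg T⟩

theorem distBM_nonneg (μ ν : NormOn n) : 0 ≤ distBM μ ν :=
  le_ciInf fun T => logDistortion_nonneg T

theorem logDistortion_symm {μ ν : NormOn n} (T : μ.Space ≃L[ℝ] ν.Space) :
    logDistortion T.symm = logDistortion T := by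
  simp only [logDistortion, ContinuousLinearEquiv.symm_symm, mul_comm]

theorem distBM_comm (μ ν : NormOn n) : distBM μ ν = distBM ν μ := by
  apply le_antisymm
  · refine le_ciInf fun T => ?_
    rw [← logDistortion_symm]
    exact ciInf_le (bddBelow_logDistortion μ ν) T.symm
  · refine le_ciInf fun T => ?_
    rw [← logDistortion_symm]
    exact ciInf_le (bddBelow_logDistortion ν μ) T.symm

theorem logDistortion_trans_le {μ ν ρ : NormOn n} (T : μ.Space ≃L[ℝ] ν.Space)
    (S : ν.Space ≃L[ℝ] ρ.Space) :
    logDistortion (T.trans S) ≤ logDistortion T + logDistortion S := by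
  rcases distortion_cases (T.trans S) with h | h
  · rw [logDistortion_of_subsingleton _ h]
    exact add_nonneg (logDistortion_nonneg T) (logDistortion_nonneg S)
  · rcases distortion_cases T with hT | hT
    · rw [logDistortion_of_subsingleton (T.trans S) hT]
      exact add_nonneg (logDistortion_nonneg T) (logDistortion_nonneg S)
    rcases distortion_cases S with hS | hS
    · rw [logDistortion_of_subsingleton (T.trans S) T.toEquiv.subsingleton]
      exact add_nonneg (logDistortion_nonneg T) (logDistortion_nonneg S)
    unfold logDistortion
    rw [← Real.log_mul (by positivity) (by positivity)]
    apply Real.log_le_log (by positivity)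
    calc ‖((T.trans S : μ.Space ≃L[ℝ] ρ.Space) : μ.Space →L[ℝ] ρ.Space)‖
          * ‖((T.trans S).symm : ρ.Space →L[ℝ] μ.Space)‖
        ≤ (‖(S : ν.Space →L[ℝ] ρ.Space)‖ * ‖(T : μ.Space →L[ℝ] ν.Space)‖)
          * (‖(T.symm : ν.Space →L[ℝ] μ.Space)‖ * ‖(S.symm : ρ.Space →L[ℝ] ν.Space)‖) := by
          gcongr
          · exact ContinuousLinearMap.opNorm_comp_le (S : ν.Space →L[ℝ] ρ.Space)
              (T : μ.Space →L[ℝ] ν.Space)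
          · exact ContinuousLinearMap.opNorm_comp_le (T.symm : ν.Space →L[ℝ] μ.Space)
              (S.symm : ρ.Space →L[ℝ] ν.Space)
      _ = _ := by ring

theorem distBM_triangle (μ ν ρ : NormOn n) : distBM μ ρ ≤ distBM μ ν + distBM ν ρ := by
  unfold distBM
  refine le_ciInf_add_ciInf fun T S => ?_
  exact (ciInf_le (bddBelow_logDistortion μ ρ) (T.trans S)).trans (logDistortion_trans_le T S)

/-- Two norms on `ℝⁿ` are equivalent when the two normed spaces are linearly isometric. -/
instance isometric (n : ℕ) : Setoid (NormOn n) where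
  r μ ν := Nonempty (μ.Space ≃ₗᵢ[ℝ] ν.Space)
  iseqv :=
    ⟨fun _ => ⟨LinearIsometryEquiv.refl ℝ _⟩, fun ⟨e⟩ => ⟨e.symm⟩,
      fun ⟨e⟩ ⟨f⟩ => ⟨e.trans f⟩⟩

theorem distBM_eq_zero_of_isometric {μ ν : NormOn n} (h : μ ≈ ν) : distBM μ ν = 0 := by
  obtain ⟨e⟩ := h
  apply le_antisymm _ (distBM_nonneg μ ν)
  refine (ciInf_le (bddBelow_logDistortion μ ν) e.toContinuousLinearEquiv).trans ?_
  apply Real.log_nonpos (by positivity)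
  apply mul_le_one₀ _ (norm_nonneg _) _
  · exact ContinuousLinearMap.opNorm_le_bound _ zero_le_one fun x => by simp
  · exact ContinuousLinearMap.opNorm_le_bound _ zero_le_one fun x => by
      rw [one_mul]; exact (e.symm.norm_map x).le

theorem isometric_of_distBM_eq_zero {μ ν : NormOn n} (h : distBM μ ν = 0) : μ ≈ ν := by
  rcases subsingleton_or_nontrivial μ.Space with hs | hs
  · have e : μ.Space ≃L[ℝ] ν.Space := Classical.arbitrary _
    exact ⟨⟨e.toLinearEquiv, fun x => by
      rw [Subsingleton.elim x 0, map_zero, norm_zero, norm_zero]⟩⟩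
  have key : ∀ k : ℕ, ∃ T : μ.Space →L[ℝ] ν.Space, T ∈ Metric.closedBall 0 1 ∧
      ∀ x, ‖x‖ ≤ Real.exp (1 / ((k : ℝ) + 1)) * ‖T x‖ := by
    intro k
    have hk : distBM μ ν < 1 / ((k : ℝ) + 1) := by rw [h]; positivity
    obtain ⟨T, hT⟩ := exists_lt_of_ciInf_lt hk
    have h1 : 1 ≤ ‖(T : μ.Space →L[ℝ] ν.Space)‖ * ‖(T.symm : ν.Space →L[ℝ] μ.Space)‖ :=
      T.one_le_norm_mul_norm_symm
    have hpos : 0 < ‖(T : μ.Space →L[ℝ] ν.Space)‖ := T.norm_pos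
    have h2 := (Real.log_lt_iff_lt_exp (by linarith)).1 hT
    refine ⟨‖(T : μ.Space →L[ℝ] ν.Space)‖⁻¹ • (T : μ.Space →L[ℝ] ν.Space), ?_, fun x => ?_⟩
    · rw [mem_closedBall_zero_iff, norm_smul, norm_inv, norm_norm, inv_mul_cancel₀ hpos.ne']
    · have h3 : ‖x‖ ≤ ‖(T.symm : ν.Space →L[ℝ] μ.Space)‖ * ‖T x‖ := by
        simpa using (T.symm : ν.Space →L[ℝ] μ.Space).le_opNorm (T x)
      rw [smul_apply, norm_smul, norm_inv, norm_norm]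
      calc ‖x‖ ≤ ‖(T.symm : ν.Space →L[ℝ] μ.Space)‖ * ‖T x‖ := h3
        _ = (‖(T : μ.Space →L[ℝ] ν.Space)‖ * ‖(T.symm : ν.Space →L[ℝ] μ.Space)‖)
            * (‖(T : μ.Space →L[ℝ] ν.Space)‖⁻¹ * ‖T x‖) := by field_simp
        _ ≤ _ := by
          gcongr
          exact le_rfl
  choose T hT hT' using key
  have : ProperSpace (μ.Space →L[ℝ] ν.Space) := FiniteDimensional.proper ℝ _
  obtain ⟨S, hS, φ, hφ, hlim⟩ :=
    (isCompact_closedBall (0 : μ.Space →L[ℝ] ν.Space) 1).tendsto_subseq hT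
  have hlimx : ∀ x, Filter.Tendsto (fun k => ‖T (φ k) x‖) Filter.atTop (𝓝 ‖S x‖) := fun x =>
    (((ContinuousLinearMap.apply ℝ ν.Space x).continuous.tendsto S).comp hlim).norm
  have hexp : Filter.Tendsto (fun k : ℕ => Real.exp (1 / ((φ k : ℝ) + 1))) Filter.atTop (𝓝 1) := by
    have := (tendsto_one_div_add_atTop_nhds_zero_nat (𝕜 := ℝ)).comp hφ.tendsto_atTop
    have h0 := (Real.continuous_exp.tendsto 0).comp this
    rw [Real.exp_zero] at h0
    exact h0
  have hiso : ∀ x, ‖S x‖ = ‖x‖ := by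
    intro x
    apply le_antisymm
    · simpa using S.le_of_opNorm_le (mem_closedBall_zero_iff.1 hS) x
    · have := ge_of_tendsto' (hexp.mul (hlimx x)) fun k => hT' (φ k) x
      simpa using this
  let J : μ.Space →ₗᵢ[ℝ] ν.Space := ⟨S.toLinearMap, hiso⟩
  exact ⟨J.toLinearIsometryEquiv (by rw [finrank_space, finrank_space])⟩

end NormOn

/-- The `n`-dimensional Banach–Mazur compactum: isometry classes of norms on `ℝⁿ`. -/
def BanachMazur (n : ℕ) : Type := Quotient (NormOn.isometric n)

/-- The Banach–Mazur compactum is metrized by the Banach–Mazur distance. -/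
instance (n : ℕ) : MetricSpace (BanachMazur n) where
  dist := Quotient.lift₂ NormOn.distBM (by
    intro μ ν μ' ν' hμ hν
    have h1 := NormOn.distBM_eq_zero_of_isometric hμ
    have h2 := NormOn.distBM_eq_zero_of_isometric hν
    have h3 := NormOn.distBM_eq_zero_of_isometric (Setoid.symm hμ)
    have h4 := NormOn.distBM_eq_zero_of_isometric (Setoid.symm hν)
    have a1 := NormOn.distBM_triangle μ μ' ν
    have a2 := NormOn.distBM_triangle μ' ν' ν
    have a3 := NormOn.distBM_triangle μ' μ ν'
    have a4 := NormOn.distBM_triangle μ ν ν'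
    linarith)
  dist_self := by
    rintro ⟨μ⟩
    exact NormOn.distBM_eq_zero_of_isometric (Setoid.refl μ)
  dist_comm := by
    rintro ⟨μ⟩ ⟨ν⟩
    exact NormOn.distBM_comm μ ν
  dist_triangle := by
    rintro ⟨μ⟩ ⟨ν⟩ ⟨ρ⟩
    exact NormOn.distBM_triangle μ ν ρ
  eq_of_dist_eq_zero := by
    rintro ⟨μ⟩ ⟨ν⟩ h
    exact Quotient.sound (NormOn.isometric_of_distBM_eq_zero h)

/-- The set of all isometry classes of finite-dimensional real normed spaces, with the disjoint
union topology of the Banach–Mazur compacta (the topology of a sigma type). -/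
abbrev BM : Type := Σ n : ℕ, BanachMazur n

/-- A finite-dimensional normed space representing the isometry class `E`. -/
def BM.Rep (E : BM) : Type := (Quotient.out E.2 : NormOn E.1).Space

instance (E : BM) : NormedAddCommGroup E.Rep :=
  inferInstanceAs (NormedAddCommGroup (Quotient.out E.2 : NormOn E.1).Space)

instance (E : BM) : NormedSpace ℝ E.Rep :=
  inferInstanceAs (NormedSpace ℝ (Quotient.out E.2 : NormOn E.1).Space)

instance (E : BM) : FiniteDimensional ℝ E.Rep :=
  inferInstanceAs (FiniteDimensional ℝ (Quotient.out E.2 : NormOn E.1).Space)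

/-- The set of all linear operators `T : X → Y` with
`e^{-C} ‖x‖ ≤ ‖T x‖ ≤ e^C ‖x‖` for every `x`. -/
def Emb (C : ℝ) (X Y : Type*) [NormedAddCommGroup X] [NormedSpace ℝ X]
    [NormedAddCommGroup Y] [NormedSpace ℝ Y] : Set (X →L[ℝ] Y) :=
  {T | ∀ x, Real.exp (-C) * ‖x‖ ≤ ‖T x‖ ∧ ‖T x‖ ≤ Real.exp C * ‖x‖}

/-- The age of `X`: all finite-dimensional normed spaces that are isometric to a subspace
of `X`. -/
def Age (X : Type*) [NormedAddCommGroup X] [NormedSpace ℝ X] : Set BM :=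
  {E | ∃ V : Submodule ℝ X, Nonempty (E.Rep ≃ₗᵢ[ℝ] V)}

/-- `Y` is finitely representable in `X`. -/
def FinitelyRepresentable (Y X : Type*) [NormedAddCommGroup Y] [NormedSpace ℝ Y]
    [NormedAddCommGroup X] [NormedSpace ℝ X] : Prop :=
  ∀ V : Submodule ℝ Y, FiniteDimensional ℝ V → ∀ ε : ℝ, 0 < ε → (Emb ε V X).Nonempty

/-- `X` is relatively universal: every separable Banach space that is finitely representable
in `X` embeds isometrically into `X`. Every separable Banach space is isometric to one whose
carrier lives in `Type`, so it suffices to quantify over those. -/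
def RelativelyUniversal (X : Type*) [NormedAddCommGroup X] [NormedSpace ℝ X] : Prop :=
  ∀ (Y : Type) [NormedAddCommGroup Y] [NormedSpace ℝ Y] [CompleteSpace Y]
    [TopologicalSpace.SeparableSpace Y],
    FinitelyRepresentable Y X → Nonempty (Y →ₗᵢ[ℝ] X)

/-- The `ω`-amalgamation property. -/
def OmegaAmalgamationProperty (K : Set BM) : Prop :=
  ∀ E ∈ K, ∀ C : ℝ, 0 < C → ∀ ε : ℝ, 0 < ε →
    ∀ F : ℕ → BM, (∀ n, F n ∈ K) →
    ∀ f : (n : ℕ) → (E.Rep →L[ℝ] (F n).Rep), (∀ n, f n ∈ Emb C E.Rep (F n).Rep) →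
    ∃ m n : ℕ, m ≠ n ∧ ∃ G ∈ K, ∃ (g : (F m).Rep →ₗᵢ[ℝ] G.Rep) (h : (F n).Rep →ₗᵢ[ℝ] G.Rep),
      ‖g.toContinuousLinearMap ∘L f m - h.toContinuousLinearMap ∘L f n‖ < ε

/-- The hereditary property (HP). -/
def Hereditary (K : Set BM) : Prop :=
  ∀ F ∈ K, ∀ E : BM, Nonempty (E.Rep →ₗᵢ[ℝ] F.Rep) → E ∈ K

/-- The joint embedding property (JEP). -/
def JointEmbeddingProperty (K : Set BM) : Prop :=
  ∀ F ∈ K, ∀ G ∈ K, ∃ H ∈ K,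
    Nonempty (F.Rep →ₗᵢ[ℝ] H.Rep) ∧ Nonempty (G.Rep →ₗᵢ[ℝ] H.Rep)

/-- The guarded amalgamation property (GAP). -/
def GuardedAmalgamationProperty (K : Set BM) : Prop :=
  ∀ E ∈ K, ∀ ε : ℝ, 0 < ε →
    ∃ F ∈ K, ∃ φ ∈ Emb ε E.Rep F.Rep, ∃ δ : ℝ, 0 < δ ∧
      ∀ G ∈ K, ∀ H ∈ K, ∀ ψG ∈ Emb δ F.Rep G.Rep, ∀ ψH ∈ Emb δ F.Rep H.Rep,
        ∃ L ∈ K, ∃ (ιG : G.Rep →ₗᵢ[ℝ] L.Rep) (ιH : H.Rep →ₗᵢ[ℝ] L.Rep),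
          ‖ιG.toContinuousLinearMap ∘L ψG ∘L φ - ιH.toContinuousLinearMap ∘L ψH ∘L φ‖ < ε

/-- A guarded Fraïssé class of finite-dimensional normed spaces. -/
structure IsGuardedFraisseClass (K : Set BM) : Prop where
  nonempty : K.Nonempty
  isClosed : IsClosed K
  hereditary : Hereditary K
  jointEmbedding : JointEmbeddingProperty K
  guardedAmalgamation : GuardedAmalgamationProperty K

end GuardedFraisse

end

/-! A class lies in `closure (Age X)` exactly when it embeds into `X` with distortion `e^ε` for
every `ε > 0` (`mem_closure_Age_iff`), so the closure contains all finite-dimensional subspaces of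
spaces finitely representable in `X`. Such spaces arise as ultrafilter limits of operators into `X`
(`exists_limit_space`). Hence an amalgamation that can be carried out in `X` at every small
distortion can be carried out isometrically in the closure (`exists_amalgam`); JEP is the case of
zero maps.

Suppose GAP fails at `E` and `ε`. Then every extension of `E` with some distortion to spare has two
refinements whose copies of `E` stay more than `ε / 2` apart under all embeddings into `X` within
the tolerance (`exists_incompatible_refinements`). Under `ω`-amalgamation, iterate along one side:
the discarded sides form a sequence in which no two members amalgamate within `ε / 4`. Under
relative universality, take at step `n` the side that keeps `E` away from the `n`-th term of a dense
sequence of operators `E → X`. The limit of this branch embeds into `X`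
(`exists_common_map_of_refines`) and yields an operator `E → X` at distance at least `ε / 4` from
the whole dense sequence. -/

noncomputable section

namespace GuardedFraisse

open Topology Filter

/-! ### Calculus of almost isometric embeddings -/

section Emb

variable {X Y Z : Type*} [NormedAddCommGroup X] [NormedSpace ℝ X]
  [NormedAddCommGroup Y] [NormedSpace ℝ Y] [NormedAddCommGroup Z] [NormedSpace ℝ Z]

theorem mem_Emb_mono {a b : ℝ} (h : a ≤ b) {T : X →L[ℝ] Y} (hT : T ∈ Emb a X Y) :
    T ∈ Emb b X Y := fun x =>
  ⟨(by gcongr : Real.exp (-b) * ‖x‖ ≤ Real.exp (-a) * ‖x‖).trans (hT x).1,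
    (hT x).2.trans (by gcongr)⟩

theorem comp_mem_Emb {a b : ℝ} {S : Y →L[ℝ] Z} {T : X →L[ℝ] Y} (hS : S ∈ Emb b Y Z)
    (hT : T ∈ Emb a X Y) : S ∘L T ∈ Emb (a + b) X Z := by
  intro x
  obtain ⟨h1, h2⟩ := hT x
  obtain ⟨h3, h4⟩ := hS (T x)
  constructor
  · calc Real.exp (-(a + b)) * ‖x‖ = Real.exp (-b) * (Real.exp (-a) * ‖x‖) := by
          rw [← mul_assoc, ← Real.exp_add]; ring_nf
      _ ≤ Real.exp (-b) * ‖T x‖ := by gcongr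
      _ ≤ _ := h3
  · calc ‖S (T x)‖ ≤ Real.exp b * ‖T x‖ := h4
      _ ≤ Real.exp b * (Real.exp a * ‖x‖) := by gcongr
      _ = Real.exp (a + b) * ‖x‖ := by rw [← mul_assoc, ← Real.exp_add]; ring_nf

theorem mem_Emb_of_norm_eq {c : ℝ} (hc : 0 ≤ c) {T : X →L[ℝ] Y} (hT : ∀ x, ‖T x‖ = ‖x‖) :
    T ∈ Emb c X Y := by
  refine mem_Emb_mono hc fun x => ?_
  simp [hT x]

theorem isometry_mem_Emb {c : ℝ} (hc : 0 ≤ c) (g : X →ₗᵢ[ℝ] Y) :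
    g.toContinuousLinearMap ∈ Emb c X Y :=
  mem_Emb_of_norm_eq hc fun x => g.norm_map x

theorem opNorm_le_of_mem_Emb {c : ℝ} {T : X →L[ℝ] Y} (hT : T ∈ Emb c X Y) :
    ‖T‖ ≤ Real.exp c :=
  T.opNorm_le_bound (Real.exp_pos c).le fun x => (hT x).2

theorem injective_of_mem_Emb {c : ℝ} {T : X →L[ℝ] Y} (hT : T ∈ Emb c X Y) :
    Function.Injective T := by
  refine (injective_iff_map_eq_zero T).2 fun x hx => ?_
  have h := (hT x).1
  rw [hx, norm_zero] at h
  exact norm_le_zero_iff.1 (nonpos_of_mul_nonpos_right h (Real.exp_pos _))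

end Emb

/-! ### Almost isometries and the Banach–Mazur distance -/

namespace NormOn

variable {n : ℕ} {μ ν : NormOn n}

/-- Dividing `T` by its norm moves the whole distortion to the lower bound. -/
theorem Emb_nonempty_of_logDistortion_lt {T : μ.Space ≃L[ℝ] ν.Space} {ε : ℝ}
    (hT : logDistortion T < ε) : (Emb ε μ.Space ν.Space).Nonempty := by
  rcases subsingleton_or_nontrivial μ.Space with hs | hs
  · exact ⟨T, fun x => by rw [Subsingleton.elim x 0]; simp⟩
  have h1 : 1 ≤ ‖(T : μ.Space →L[ℝ] ν.Space)‖ * ‖(T.symm : ν.Space →L[ℝ] μ.Space)‖ :=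
    T.one_le_norm_mul_norm_symm
  have hpos : 0 < ‖(T : μ.Space →L[ℝ] ν.Space)‖ := T.norm_pos
  have h2 := (Real.log_lt_iff_lt_exp (by linarith)).1 hT
  have hε : 0 ≤ ε := (logDistortion_nonneg T).trans hT.le
  refine ⟨‖(T : μ.Space →L[ℝ] ν.Space)‖⁻¹ • (T : μ.Space →L[ℝ] ν.Space), fun x => ?_⟩
  have h3 : ‖x‖ ≤ ‖(T.symm : ν.Space →L[ℝ] μ.Space)‖ * ‖T x‖ := by
    simpa using (T.symm : ν.Space →L[ℝ] μ.Space).le_opNorm (T x)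
  have h4 : ‖T x‖ ≤ ‖(T : μ.Space →L[ℝ] ν.Space)‖ * ‖x‖ :=
    (T : μ.Space →L[ℝ] ν.Space).le_opNorm x
  rw [smul_apply, norm_smul, norm_inv, norm_norm]
  change _ ≤ _ * ‖T x‖ ∧ _ * ‖T x‖ ≤ _
  constructor
  · rw [Real.exp_neg, inv_mul_le_iff₀ (Real.exp_pos ε)]
    calc ‖x‖ ≤ ‖(T.symm : ν.Space →L[ℝ] μ.Space)‖ * ‖T x‖ := h3
      _ = (‖(T : μ.Space →L[ℝ] ν.Space)‖ * ‖(T.symm : ν.Space →L[ℝ] μ.Space)‖)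
          * (‖(T : μ.Space →L[ℝ] ν.Space)‖⁻¹ * ‖T x‖) := by field_simp
      _ ≤ _ := by gcongr
  · rw [inv_mul_le_iff₀ hpos]
    refine h4.trans ?_
    gcongr
    exact le_mul_of_one_le_left (norm_nonneg x) (Real.one_le_exp hε)

theorem logDistortion_le_of_mem_Emb {T : μ.Space ≃L[ℝ] ν.Space} {δ : ℝ} (hδ : 0 ≤ δ)
    (hT : (T : μ.Space →L[ℝ] ν.Space) ∈ Emb δ μ.Space ν.Space) :
    logDistortion T ≤ 2 * δ := by
  have h1 := opNorm_le_of_mem_Emb hT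
  have h2 : ‖(T.symm : ν.Space →L[ℝ] μ.Space)‖ ≤ Real.exp δ := by
    refine ContinuousLinearMap.opNorm_le_bound _ (Real.exp_pos δ).le fun y => ?_
    have h := (hT (T.symm y)).1
    rw [Real.exp_neg, inv_mul_le_iff₀ (Real.exp_pos δ)] at h
    simpa using h
  rcases (mul_nonneg (norm_nonneg (T : μ.Space →L[ℝ] ν.Space))
    (norm_nonneg (T.symm : ν.Space →L[ℝ] μ.Space))).eq_or_lt with h | h
  -- The product vanishes only for the zero space, where the convention `log 0 = 0` applies.
  · rw [logDistortion, ← h, Real.log_zero]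
    positivity
  · rw [logDistortion, Real.log_le_iff_le_exp h, two_mul, Real.exp_add]
    gcongr

end NormOn

/-- Pull the norm back along `e`. Prescribing `n` keeps the class in a given fibre of `BM`, so
distances can be compared without casts. -/
theorem exists_isometric_rep {n : ℕ} {W : Type*} [NormedAddCommGroup W] [NormedSpace ℝ W]
    (e : (Fin n → ℝ) ≃ₗ[ℝ] W) :
    ∃ m : BanachMazur n, Nonempty (BM.Rep ⟨n, m⟩ ≃ₗᵢ[ℝ] W) := by
  let μ : NormOn n := ⟨(normSeminorm ℝ W).comp e.toLinearMap, fun x hx => by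
    simpa using hx⟩
  let m : BanachMazur n := Quotient.mk (NormOn.isometric n) μ
  obtain ⟨i⟩ : Quotient.out m ≈ μ := Quotient.mk_out μ
  let j : μ.Space ≃ₗᵢ[ℝ] W := ⟨e, fun _ => rfl⟩
  exact ⟨m, ⟨i.trans j⟩⟩

theorem exists_isometric_rep_of_finiteDimensional (W : Type*) [NormedAddCommGroup W]
    [NormedSpace ℝ W] [FiniteDimensional ℝ W] : ∃ E : BM, Nonempty (E.Rep ≃ₗᵢ[ℝ] W) := by
  obtain ⟨m, h⟩ := exists_isometric_rep
    (LinearEquiv.ofFinrankEq (Fin (Module.finrank ℝ W) → ℝ) W (by simp))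
  exact ⟨⟨_, m⟩, h⟩

theorem BM.dist_mk {n : ℕ} (a b : BanachMazur n) :
    dist a b = NormOn.distBM (Quotient.out a) (Quotient.out b) := by
  conv_lhs => rw [← Quotient.out_eq a, ← Quotient.out_eq b]
  rfl

/-! ### The closure of the age -/

section Closure

variable {X : Type*} [NormedAddCommGroup X] [NormedSpace ℝ X]

/-- The fibres of the sigma type are open, so closeness to `E` can be tested at fixed dimension by
the Banach–Mazur distance. -/
theorem mem_closure_Age_iff {E : BM} :
    E ∈ closure (Age X) ↔ ∀ ε : ℝ, 0 < ε → (Emb ε E.Rep X).Nonempty := by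
  obtain ⟨n, a⟩ := E
  constructor
  · intro h ε hε
    have ho : IsOpen (Sigma.mk (β := BanachMazur) n '' Metric.ball a ε) :=
      isOpenMap_sigmaMk _ Metric.isOpen_ball
    obtain ⟨_, ⟨b, hb, rfl⟩, V, ⟨i⟩⟩ :=
      mem_closure_iff.1 h _ ho ⟨a, Metric.mem_ball_self hε, rfl⟩
    rw [Metric.mem_ball', BM.dist_mk] at hb
    obtain ⟨T, hT⟩ := exists_lt_of_ciInf_lt hb
    obtain ⟨S, hS⟩ := NormOn.Emb_nonempty_of_logDistortion_lt hT
    have := comp_mem_Emb (isometry_mem_Emb le_rfl (V.subtypeₗᵢ.comp i.toLinearIsometry)) hS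
    rw [add_zero] at this
    exact ⟨_, this⟩
  · intro h
    rw [mem_closure_iff_nhds]
    intro U hU
    rw [Sigma.nhds_mk, Filter.mem_map, Metric.mem_nhds_iff] at hU
    obtain ⟨r, hr, hU⟩ := hU
    -- Both bounds of `Emb` enter the distortion, giving distance at most `2 * (r / 3) < r`.
    obtain ⟨T, hT⟩ := h (r / 3) (by positivity)
    let e : BM.Rep ⟨n, a⟩ ≃ₗ[ℝ] LinearMap.range T.toLinearMap :=
      LinearEquiv.ofInjective T.toLinearMap (injective_of_mem_Emb hT)
    obtain ⟨b, ⟨i⟩⟩ := exists_isometric_rep (n := n) e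
    refine ⟨⟨n, b⟩, hU ?_, _, ⟨i⟩⟩
    rw [Metric.mem_ball', BM.dist_mk]
    let S : (Quotient.out a).Space ≃L[ℝ] (Quotient.out b).Space :=
      (e.trans i.symm.toLinearEquiv).toContinuousLinearEquiv
    have hS : (S : (Quotient.out a).Space →L[ℝ] (Quotient.out b).Space) ∈ Emb (r / 3) _ _ := by
      intro x
      have : ‖S x‖ = ‖T x‖ := i.symm.norm_map (e x)
      change _ ≤ ‖S x‖ ∧ ‖S x‖ ≤ _
      rw [this]
      exact hT x
    have h1 := NormOn.logDistortion_le_of_mem_Emb (by positivity) hS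
    have h2 := ciInf_le (NormOn.bddBelow_logDistortion _ _) S
    change NormOn.distBM (Quotient.out a) (Quotient.out b) ≤ _ at h2
    linarith

theorem nonempty_closure_Age : (closure (Age X)).Nonempty := by
  obtain ⟨E, h⟩ := exists_isometric_rep_of_finiteDimensional (⊥ : Submodule ℝ X)
  exact ⟨E, subset_closure ⟨⊥, h⟩⟩

theorem hereditary_closure_Age : Hereditary (closure (Age X)) := by
  rintro F hF E ⟨i⟩
  rw [mem_closure_Age_iff] at hF ⊢
  intro ε hε
  obtain ⟨T, hT⟩ := hF ε hε
  have := comp_mem_Emb hT (isometry_mem_Emb le_rfl i)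
  rw [zero_add] at this
  exact ⟨_, this⟩

end Closure

/-! ### Uniform estimates on finite-dimensional spaces -/

section Limit

variable {W X Z : Type*} [NormedAddCommGroup W] [NormedSpace ℝ W] [FiniteDimensional ℝ W]
  [NormedAddCommGroup X] [NormedSpace ℝ X] [NormedAddCommGroup Z] [NormedSpace ℝ Z]

/-- One constant serves all operators, so bounds on a basis make a family equi-Lipschitz. -/
theorem exists_norm_le_of_basis (Z : Type*) [NormedAddCommGroup Z] [NormedSpace ℝ Z]
    {ι : Type*} [Fintype ι] (b : Module.Basis ι ℝ W) :
    ∃ C : ℝ, 0 < C ∧ ∀ (T : W →ₗ[ℝ] Z) (M : ℝ), 0 ≤ M → (∀ i, ‖T (b i)‖ ≤ M) →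
      ∀ w, ‖T w‖ ≤ C * M * ‖w‖ := by
  obtain ⟨C, hC, h⟩ := b.exists_opNorm_le (F := Z)
  refine ⟨C, hC, fun T M hM hT w => ?_⟩
  exact (LinearMap.toContinuousLinearMap T).le_of_opNorm_le (h hM hT) w

/-- Pointwise convergence of norms along a sequence of operators on a finite-dimensional space is
uniform on the unit ball. -/
theorem eventually_abs_norm_sub_le {α : Type*} {l : Filter α} {S : α → W →ₗ[ℝ] X}
    {J : W →ₗ[ℝ] Z} (h : ∀ w, Tendsto (fun k => ‖S k w‖) l (𝓝 ‖J w‖)) {δ : ℝ} (hδ : 0 < δ) :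
    ∀ᶠ k in l, ∀ w, |‖S k w‖ - ‖J w‖| ≤ δ * ‖w‖ := by
  let b := Module.finBasis ℝ W
  obtain ⟨C, hC, hCS⟩ := exists_norm_le_of_basis X b
  obtain ⟨D, hD, hDJ⟩ : ∃ D : ℝ, 0 < D ∧ ∀ w, ‖J w‖ ≤ D * ‖w‖ := by
    refine ⟨‖LinearMap.toContinuousLinearMap J‖ + 1, by positivity, fun w => ?_⟩
    exact (LinearMap.toContinuousLinearMap J).le_of_opNorm_le (by linarith) w
  obtain ⟨M, hM, hMJ⟩ : ∃ M : ℝ, 0 ≤ M ∧ ∀ i, ‖J (b i)‖ + 1 ≤ M := by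
    refine ⟨∑ i, (‖J (b i)‖ + 1), by positivity, fun i => ?_⟩
    exact Finset.single_le_sum (f := fun i => ‖J (b i)‖ + 1)
      (fun i _ => by positivity) (Finset.mem_univ i)
  have hSM : ∀ᶠ k in l, ∀ i, ‖S k (b i)‖ ≤ M := by
    refine eventually_all.2 fun i => ?_
    filter_upwards [(h (b i)).eventually (gt_mem_nhds (lt_add_one _))] with k hk
    exact hk.le.trans (hMJ i)
  -- Moving to a point of an `r`-net costs at most `C * M * r + D * r = δ / 3`; the error at that
  -- point is below `δ / 3`.
  set r : ℝ := δ / 3 / (C * M + D) with hr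
  have hr0 : 0 < r := by positivity
  have hrmul : (C * M + D) * r = δ / 3 := by
    rw [hr]; field_simp
  have : ProperSpace W := FiniteDimensional.proper ℝ W
  obtain ⟨t, -, htf, ht⟩ := finite_cover_balls_of_compact (isCompact_closedBall (0 : W) 1) hr0
  have hclose : ∀ᶠ k in l, ∀ x ∈ t, |‖S k x‖ - ‖J x‖| < δ / 3 := by
    refine (eventually_all_finite htf).2 fun x _ => ?_
    have := (Metric.tendsto_nhds.1 (h x)) (δ / 3) (by positivity)
    simpa only [Real.dist_eq] using this
  filter_upwards [hSM, hclose] with k hk1 hk2 w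
  have hS := hCS (S k) M hM hk1
  rcases eq_or_ne w 0 with rfl | hw
  · simp
  have hw' : 0 < ‖w‖ := norm_pos_iff.2 hw
  have key : ∀ u : W, ‖u‖ ≤ 1 → |‖S k u‖ - ‖J u‖| ≤ δ := by
    intro u hu
    obtain ⟨x, hx, hux⟩ := Set.mem_iUnion₂.1 (ht (mem_closedBall_zero_iff.2 hu))
    rw [mem_ball_iff_norm] at hux
    have h1 : |‖S k u‖ - ‖S k x‖| ≤ C * M * r := by
      refine (abs_norm_sub_norm_le _ _).trans ?_
      rw [← map_sub]
      exact (hS _).trans (by gcongr)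
    have h2 : |‖J u‖ - ‖J x‖| ≤ D * r := by
      refine (abs_norm_sub_norm_le _ _).trans ?_
      rw [← map_sub]
      exact (hDJ _).trans (by gcongr)
    have h3 := hk2 x hx
    rw [abs_le] at *
    rw [abs_lt] at h3
    constructor <;> nlinarith
  have h4 := key (‖w‖⁻¹ • w) (by rw [norm_smul, norm_inv, norm_norm, inv_mul_cancel₀ hw'.ne'])
  rw [map_smul, map_smul, norm_smul, norm_smul, norm_inv, norm_norm, ← mul_sub, abs_mul,
    abs_of_pos (inv_pos.2 hw'), inv_mul_le_iff₀ hw'] at h4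
  linarith

/-- The range of `i` need not lie in that of `J`, but moving the images of a basis into it by `δ /
C` changes the operator by at most `δ`. -/
theorem exists_lift_of_denseRange {V : Type*} [AddCommGroup V] [Module ℝ V] {J : V →ₗ[ℝ] Z}
    (hJ : DenseRange J) (i : W →ₗ[ℝ] Z) {δ : ℝ} (hδ : 0 < δ) :
    ∃ B : W →ₗ[ℝ] V, ∀ w, ‖J (B w) - i w‖ ≤ δ * ‖w‖ := by
  let b := Module.finBasis ℝ W
  obtain ⟨C, hC, h⟩ := exists_norm_le_of_basis Z b
  have : ∀ k, ∃ v, ‖J v - i (b k)‖ ≤ δ / C := by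
    intro k
    obtain ⟨v, hv⟩ := hJ.exists_dist_lt (i (b k)) (div_pos hδ hC)
    refine ⟨v, ?_⟩
    rw [dist_comm, dist_eq_norm] at hv
    exact hv.le
  choose v hv using this
  refine ⟨b.constr ℝ v, fun w => ?_⟩
  have h1 := h (J ∘ₗ b.constr ℝ v - i) (δ / C) (by positivity)
    (fun k => by simpa [Module.Basis.constr_basis] using hv k) w
  rwa [mul_div_cancel₀ _ hC.ne'] at h1

end Limit

/-- `UniformSpace.Completion` is the Hausdorff completion, so it also divides out the null vectors
of `p`. -/
theorem exists_dense_map_of_seminorm {V : Type} [AddCommGroup V] [Module ℝ V]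
    (p : Seminorm ℝ V) :
    ∃ (Y : Type) (_ : NormedAddCommGroup Y) (_ : NormedSpace ℝ Y) (_ : CompleteSpace Y)
      (J : V →ₗ[ℝ] Y), DenseRange J ∧ ∀ v, ‖J v‖ = p v := by
  let : SeminormedAddCommGroup V := p.toAddGroupSeminorm.toSeminormedAddCommGroup
  let : NormedSpace ℝ V := ⟨fun a x => (map_smul_eq_mul p a x).le⟩
  refine ⟨UniformSpace.Completion V, inferInstance, inferInstance, inferInstance,
    (UniformSpace.Completion.toComplL (𝕜 := ℝ) (E := V)).toLinearMap, ?_, fun v => ?_⟩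
  · exact UniformSpace.Completion.denseRange_coe
  · exact UniformSpace.Completion.norm_coe v

/-! ### Ultrafilter limits of operators into `X` -/

section LimitSpace

variable {V : Type} [AddCommGroup V] [Module ℝ V]
  {X : Type*} [NormedAddCommGroup X] [NormedSpace ℝ X]

theorem exists_seminorm_tendsto (S : ℕ → V →ₗ[ℝ] X) (hS : ∀ v, ∃ C, ∀ k, ‖S k v‖ ≤ C) :
    ∃ p : Seminorm ℝ V, ∀ v, Tendsto (fun k => ‖S k v‖) (hyperfilter ℕ) (𝓝 (p v)) := by
  have : ∀ v, ∃ a, Tendsto (fun k => ‖S k v‖) (hyperfilter ℕ) (𝓝 a) := by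
    intro v
    obtain ⟨C, hC⟩ := hS v
    obtain ⟨a, -, ha⟩ := (isCompact_Icc (a := (0 : ℝ)) (b := C)).ultrafilter_le_nhds
      ((hyperfilter ℕ).map fun k => ‖S k v‖)
      (by
        rw [le_principal_iff, Ultrafilter.coe_map, mem_map]
        exact univ_mem' fun k => ⟨norm_nonneg _, hC k⟩)
    exact ⟨a, ha⟩
  choose p hp using this
  refine ⟨Seminorm.of p (fun x y => ?_) (fun a x => ?_), hp⟩
  · refine le_of_tendsto_of_tendsto' (hp (x + y)) ((hp x).add (hp y)) fun k => ?_
    rw [map_add]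
    exact norm_add_le _ _
  · refine tendsto_nhds_unique (hp (a • x)) ?_
    simpa only [map_smul, norm_smul] using (hp x).const_mul ‖a‖

/-- A pointwise bounded sequence of operators `V → X` has a limit `V → Y`, where `Y` is a separable
Banach space finitely representable in `X`. -/
theorem exists_limit_space (S : ℕ → V →ₗ[ℝ] X) (hS : ∀ v, ∃ C, ∀ k, ‖S k v‖ ≤ C)
    {s : Set V} (hs : s.Countable) (hspan : Submodule.span ℝ s = ⊤) :
    ∃ (Y : Type) (_ : NormedAddCommGroup Y) (_ : NormedSpace ℝ Y) (_ : CompleteSpace Y)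
      (_ : TopologicalSpace.SeparableSpace Y) (J : V →ₗ[ℝ] Y),
      FinitelyRepresentable Y X ∧
        ∀ v, Tendsto (fun k => ‖S k v‖) (hyperfilter ℕ) (𝓝 ‖J v‖) := by
  obtain ⟨p, hp⟩ := exists_seminorm_tendsto S hS
  obtain ⟨Y, _, _, _, J, hJd, hJ⟩ := exists_dense_map_of_seminorm p
  have hlim : ∀ v, Tendsto (fun k => ‖S k v‖) (hyperfilter ℕ) (𝓝 ‖J v‖) := fun v => by
    rw [hJ]; exact hp v
  have hsep : TopologicalSpace.SeparableSpace Y := by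
    rw [← TopologicalSpace.isSeparable_univ_iff, ← hJd.closure_range]
    apply TopologicalSpace.IsSeparable.closure
    rw [← LinearMap.coe_range, ← Submodule.map_top, ← hspan, Submodule.map_span]
    exact ((hs.image J).isSeparable).span (R := ℝ)
  refine ⟨Y, inferInstance, inferInstance, inferInstance, hsep, J, ?_, hlim⟩
  intro W _ ε hε
  have hε1 : Real.exp (-ε) < 1 := by rw [Real.exp_lt_one_iff]; linarith
  -- The lift into `V` and the passage to stage `k` each cost `δ / 2`. The lower bound is then
  -- exactly `e^{-ε}`, and `1 + δ ≤ e^ε` since `e^ε + e^{-ε} ≥ 2`.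
  set δ : ℝ := 1 - Real.exp (-ε) with hδ
  have hδ0 : 0 < δ / 2 := by linarith
  have hδ2 : 1 + δ ≤ Real.exp ε := by
    have h1 : Real.exp ε * Real.exp (-ε) = 1 := by rw [← Real.exp_add]; simp
    nlinarith [sq_nonneg (Real.exp ε - 1), Real.exp_pos ε, Real.exp_pos (-ε)]
  obtain ⟨B, hB⟩ := exists_lift_of_denseRange hJd W.subtype hδ0
  obtain ⟨k, hk⟩ := (eventually_abs_norm_sub_le (S := fun k => S k ∘ₗ B) (J := J ∘ₗ B)
    (fun w => hlim (B w)) hδ0).exists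
  refine ⟨LinearMap.toContinuousLinearMap (S k ∘ₗ B), fun w => ?_⟩
  have h1 := abs_le.1 (hk w)
  have h2 := abs_le.1 ((abs_norm_sub_norm_le _ _).trans (hB w))
  have h3 : ‖W.subtype w‖ = ‖w‖ := rfl
  rw [h3] at h2
  simp only [LinearMap.comp_apply, LinearMap.coe_toContinuousLinearMap'] at h1 ⊢
  have h4 : Real.exp (-ε) = 1 - δ := by rw [hδ]; ring
  have h5 := mul_le_mul_of_nonneg_right hδ2 (norm_nonneg w)
  rw [h4]
  constructor <;> linarith

end LimitSpace

/-! ### From approximate amalgams in `X` to isometric ones -/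

section Amalgam

variable {X : Type*} [NormedAddCommGroup X] [NormedSpace ℝ X]

theorem exists_mem_closure_Age_of_submodule {Y : Type*} [NormedAddCommGroup Y]
    [NormedSpace ℝ Y] (hY : FinitelyRepresentable Y X) (W : Submodule ℝ Y)
    [FiniteDimensional ℝ W] : ∃ L ∈ closure (Age X), Nonempty (L.Rep ≃ₗᵢ[ℝ] W) := by
  obtain ⟨L, ⟨i⟩⟩ := exists_isometric_rep_of_finiteDimensional W
  refine ⟨L, mem_closure_Age_iff.2 fun ε hε => ?_, ⟨i⟩⟩
  obtain ⟨T, hT⟩ := hY W inferInstance ε hε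
  have := comp_mem_Emb hT (isometry_mem_Emb le_rfl i.toLinearIsometry)
  rw [zero_add] at this
  exact ⟨_, this⟩

/-- If `f : E → G` and `f' : E → H` can be approximately amalgamated in `X` by almost isometric
embeddings, then they can be amalgamated in `closure (Age X)` by isometric ones. -/
theorem exists_amalgam {E : Type*} [NormedAddCommGroup E] [NormedSpace ℝ E] {G H : BM}
    (f : E →L[ℝ] G.Rep) (f' : E →L[ℝ] H.Rep) {r : ℝ} (hr : 0 ≤ r)
    (h : ∀ δ : ℝ, 0 < δ → ∃ j ∈ Emb δ G.Rep X, ∃ j' ∈ Emb δ H.Rep X, ‖j ∘L f - j' ∘L f'‖ ≤ r) :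
    ∃ L ∈ closure (Age X), ∃ (g : G.Rep →ₗᵢ[ℝ] L.Rep) (g' : H.Rep →ₗᵢ[ℝ] L.Rep),
      ‖g.toContinuousLinearMap ∘L f - g'.toContinuousLinearMap ∘L f'‖ ≤ r := by
  have hpos : ∀ k : ℕ, (0 : ℝ) < 1 / ((k : ℝ) + 1) := fun k => by positivity
  choose j hj j' hj' hjj using fun k : ℕ => h _ (hpos k)
  -- The amalgam will be the image of `G × H` under the limit of these operators; it is isometric on
  -- each factor because the distortions `1 / (k + 1)` tend to `0`.
  let S : ℕ → G.Rep × H.Rep →ₗ[ℝ] X := fun k =>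
    (j k).toLinearMap.coprod (j' k).toLinearMap
  have hSapp : ∀ k v, S k v = j k v.1 + j' k v.2 := fun k v => rfl
  have hS : ∀ v, ∃ C, ∀ k, ‖S k v‖ ≤ C := by
    intro v
    refine ⟨Real.exp 1 * ‖v.1‖ + Real.exp 1 * ‖v.2‖, fun k => ?_⟩
    have h1 : 1 / ((k : ℝ) + 1) ≤ 1 := by
      rw [div_le_one (by positivity)]; linarith [(Nat.cast_nonneg k : (0 : ℝ) ≤ k)]
    rw [hSapp]
    exact (norm_add_le _ _).trans (add_le_add (mem_Emb_mono h1 (hj k) _).2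
      (mem_Emb_mono h1 (hj' k) _).2)
  obtain ⟨s, hs⟩ := Module.Finite.fg_top (R := ℝ) (M := G.Rep × H.Rep)
  obtain ⟨Y, _, _, _, _, J, hfr, hJ⟩ := exists_limit_space S hS s.countable_toSet hs
  obtain ⟨L, hL, ⟨i⟩⟩ := exists_mem_closure_Age_of_submodule hfr (LinearMap.range J)
  have h0 : Tendsto (fun k : ℕ => 1 / ((k : ℝ) + 1)) (hyperfilter ℕ) (𝓝 0) :=
    (tendsto_one_div_add_atTop_nhds_zero_nat (𝕜 := ℝ)).mono_left Nat.hyperfilter_le_atTop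
  have hlim : ∀ (x : ℝ) (u : ℕ → ℝ), (∀ k : ℕ, Real.exp (-(1 / ((k : ℝ) + 1))) * x ≤ u k ∧
      u k ≤ Real.exp (1 / ((k : ℝ) + 1)) * x) → Tendsto u (hyperfilter ℕ) (𝓝 x) := by
    intro x u hu
    have h1 := ((Real.continuous_exp.tendsto 0).comp h0).mul_const x
    have h2 := ((Real.continuous_exp.tendsto (-0)).comp h0.neg).mul_const x
    rw [neg_zero] at h2
    rw [Real.exp_zero, one_mul] at h1 h2
    exact tendsto_of_tendsto_of_tendsto_of_le_of_le h2 h1 (fun k => (hu k).1) fun k => (hu k).2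
  have hG : ∀ x, ‖J (x, 0)‖ = ‖x‖ := fun x =>
    tendsto_nhds_unique (hJ (x, 0)) (hlim _ _ fun k : ℕ => by
      have := hj k x
      simpa [hSapp] using this)
  have hH : ∀ x, ‖J (0, x)‖ = ‖x‖ := fun x =>
    tendsto_nhds_unique (hJ (0, x)) (hlim _ _ fun k : ℕ => by
      have := hj' k x
      simpa [hSapp] using this)
  let R : G.Rep × H.Rep →ₗ[ℝ] L.Rep := i.symm.toLinearEquiv.toLinearMap ∘ₗ J.rangeRestrict
  have hR : ∀ v, ‖R v‖ = ‖J v‖ := fun v => i.symm.norm_map _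
  let g : G.Rep →ₗᵢ[ℝ] L.Rep := ⟨R ∘ₗ LinearMap.inl ℝ _ _, fun x => (hR _).trans (hG x)⟩
  let g' : H.Rep →ₗᵢ[ℝ] L.Rep := ⟨R ∘ₗ LinearMap.inr ℝ _ _, fun x => (hR _).trans (hH x)⟩
  refine ⟨L, hL, g, g', ContinuousLinearMap.opNorm_le_bound _ hr fun e => ?_⟩
  have h1 : (g.toContinuousLinearMap ∘L f - g'.toContinuousLinearMap ∘L f') e
      = R (f e, -f' e) := by
    change R (f e, 0) - R (0, f' e) = _
    rw [← map_sub]; simp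
  rw [h1, hR]
  refine le_of_tendsto' (hJ _) fun k => ?_
  have h2 : S k (f e, -f' e) = (j k ∘L f - j' k ∘L f') e := by
    rw [hSapp]; simp [sub_eq_add_neg]
  rw [h2]
  exact ContinuousLinearMap.le_of_opNorm_le _ (hjj k) e

/-- Amalgamating over zero maps leaves no norm condition to meet. -/
theorem jointEmbedding_closure_Age : JointEmbeddingProperty (closure (Age X)) := by
  intro F hF G hG
  rw [mem_closure_Age_iff] at hF hG
  obtain ⟨L, hL, g, g', -⟩ := exists_amalgam (X := X) (0 : ℝ →L[ℝ] F.Rep) (0 : ℝ →L[ℝ] G.Rep)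
    le_rfl fun δ hδ => by
      obtain ⟨j, hj⟩ := hF δ hδ
      obtain ⟨j', hj'⟩ := hG δ hδ
      exact ⟨j, hj, j', hj', by simp⟩
  exact ⟨L, hL, ⟨g⟩, ⟨g'⟩⟩

end Amalgam

/-! ### Extensions with a distortion budget -/

/-- An operator from a fixed space `E` to a finite-dimensional space, together with a tolerance. -/
structure Extension (E : Type*) [NormedAddCommGroup E] [NormedSpace ℝ E] where
  space : BM
  map : E →L[ℝ] space.Rep
  tol : ℝ

namespace Extension

variable {E : Type*} [NormedAddCommGroup E] [NormedSpace ℝ E]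

/-- `t` refines `s` when its operator factors through that of `s` by an almost isometric embedding
whose distortion is controlled by the decrease of the tolerance. -/
def Refines (t s : Extension E) : Prop :=
  t.tol ≤ s.tol ∧ ∃ T ∈ Emb (s.tol - t.tol) s.space.Rep t.space.Rep, T ∘L s.map = t.map

theorem Refines.refl (s : Extension E) : s.Refines s :=
  ⟨le_rfl, ContinuousLinearMap.id ℝ _,
    mem_Emb_of_norm_eq (sub_self s.tol).ge fun _ => rfl, rfl⟩

/-- Charging distortion to the drop in tolerance makes the costs telescope. Likewise, an embedding
within the tolerance of a refinement pulls back to one within the original tolerance. -/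
theorem Refines.trans {u t s : Extension E} (h : u.Refines t) (h' : t.Refines s) :
    u.Refines s := by
  obtain ⟨h1, T, hT, hTm⟩ := h
  obtain ⟨h2, T', hT', hTm'⟩ := h'
  refine ⟨h1.trans h2, T ∘L T', ?_, ?_⟩
  · have := comp_mem_Emb hT hT'
    rwa [sub_add_sub_cancel] at this
  · rw [ContinuousLinearMap.comp_assoc, hTm', hTm]

theorem Refines.of_succ {s : ℕ → Extension E} (h : ∀ n, (s (n + 1)).Refines (s n)) {n m : ℕ}
    (hnm : n ≤ m) : (s m).Refines (s n) := by
  induction m, hnm using Nat.le_induction with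
  | base => exact Refines.refl _
  | succ m _ ih => exact (h m).trans ih

end Extension

/-! ### Failure of guarded amalgamation and sequences of refinements -/

section Chains

open Extension

variable {X : Type*} [NormedAddCommGroup X] [NormedSpace ℝ X]

/-- The guarded amalgamation property fails at `E` and `ε`. -/
def GuardFails (K : Set BM) (E : BM) (ε : ℝ) : Prop :=
  ∀ F ∈ K, ∀ φ ∈ Emb ε E.Rep F.Rep, ∀ δ : ℝ, 0 < δ →
    ∃ G ∈ K, ∃ H ∈ K, ∃ ψG ∈ Emb δ F.Rep G.Rep, ∃ ψH ∈ Emb δ F.Rep H.Rep,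
      ∀ L ∈ K, ∀ (ιG : G.Rep →ₗᵢ[ℝ] L.Rep) (ιH : H.Rep →ₗᵢ[ℝ] L.Rep),
        ε ≤ ‖ιG.toContinuousLinearMap ∘L ψG ∘L φ - ιH.toContinuousLinearMap ∘L ψH ∘L φ‖

theorem guardedAmalgamationProperty_of_not_guardFails {K : Set BM}
    (h : ∀ E ∈ K, ∀ ε : ℝ, 0 < ε → ¬ GuardFails K E ε) : GuardedAmalgamationProperty K := by
  intro E hE ε hε
  have := h E hE ε hε
  unfold GuardFails at this
  push Not at this
  exact this

/-- The extensions of `E` in `K` whose distortion plus tolerance is at most `ε`. -/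
def Admissible (K : Set BM) (E : BM) (ε : ℝ) (s : Extension E.Rep) : Prop :=
  s.space ∈ K ∧ 0 < s.tol ∧ s.map ∈ Emb (ε - s.tol) E.Rep s.space.Rep

theorem Admissible.of_refines {K : Set BM} {E : BM} {ε : ℝ} {s t : Extension E.Rep}
    (hs : Admissible K E ε s) (ht : t.space ∈ K) (h0 : 0 < t.tol) (h : t.Refines s) :
    Admissible K E ε t := by
  obtain ⟨-, T, hT, hTm⟩ := h
  refine ⟨ht, h0, ?_⟩
  have := comp_mem_Emb hT hs.2.2
  rwa [hTm, sub_add_sub_cancel] at this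

/-- If the guarded amalgamation property fails, then every admissible extension has two refinements
that remain incompatible in `X`. -/
theorem exists_incompatible_refinements {E : BM} {ε : ℝ} (hε : 0 < ε)
    (h : GuardFails (closure (Age X)) E ε) (s : Extension E.Rep)
    (hs : Admissible (closure (Age X)) E ε s) :
    ∃ t s' : Extension E.Rep, t.Refines s ∧ s'.Refines s ∧
      Admissible (closure (Age X)) E ε t ∧ Admissible (closure (Age X)) E ε s' ∧
      t.tol = s'.tol ∧
      ∀ j ∈ Emb s'.tol t.space.Rep X, ∀ j' ∈ Emb s'.tol s'.space.Rep X,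
        ε / 2 < ‖j ∘L t.map - j' ∘L s'.map‖ := by
  obtain ⟨hsK, hs0, hsm⟩ := hs
  obtain ⟨G, hG, H, hH, ψG, hψG, ψH, hψH, hbad⟩ :=
    h s.space hsK s.map (mem_Emb_mono (by linarith) hsm) (s.tol / 2) (by positivity)
  -- Otherwise `exists_amalgam` would give an amalgam in the closure with error at most `ε / 2`,
  -- against `hbad`.
  have hstab : ∃ δ : ℝ, 0 < δ ∧ ∀ j ∈ Emb δ G.Rep X, ∀ j' ∈ Emb δ H.Rep X,
      ε / 2 < ‖j ∘L (ψG ∘L s.map) - j' ∘L (ψH ∘L s.map)‖ := by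
    by_contra! hcon
    obtain ⟨L, hL, g, g', hgg⟩ := exists_amalgam (X := X) (ψG ∘L s.map) (ψH ∘L s.map)
      (by positivity : 0 ≤ ε / 2) hcon
    linarith [hbad L hL g g']
  obtain ⟨δ, hδ, hj⟩ := hstab
  -- Half of `s.tol` pays for `ψG` and `ψH`; the new tolerance fits in the other half.
  set η := min δ (s.tol / 2) with hη
  have hη0 : 0 < η := lt_min hδ (by positivity)
  have hηs : η ≤ s.tol / 2 := min_le_right _ _
  let t : Extension E.Rep := ⟨G, ψG ∘L s.map, η⟩
  let s' : Extension E.Rep := ⟨H, ψH ∘L s.map, η⟩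
  have ht : t.Refines s := ⟨by change η ≤ s.tol; linarith, ψG, mem_Emb_mono
    (by change s.tol / 2 ≤ s.tol - η; linarith) hψG, rfl⟩
  have hs' : s'.Refines s := ⟨by change η ≤ s.tol; linarith, ψH, mem_Emb_mono
    (by change s.tol / 2 ≤ s.tol - η; linarith) hψH, rfl⟩
  have hs : Admissible (closure (Age X)) E ε s := ⟨hsK, hs0, hsm⟩
  exact ⟨t, s', ht, hs', hs.of_refines hG hη0 ht, hs.of_refines hH hη0 hs', rfl,
    fun j hj1 j' hj2 => hj j (mem_Emb_mono (min_le_left _ _) hj1) j'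
      (mem_Emb_mono (min_le_left _ _) hj2)⟩

/-- The trivial extension. -/
def idExtension (E : BM) (ε : ℝ) : Extension E.Rep := ⟨E, ContinuousLinearMap.id ℝ _, ε⟩

theorem admissible_idExtension {K : Set BM} {E : BM} (hE : E ∈ K) {ε : ℝ} (hε : 0 < ε) :
    Admissible K E ε (idExtension E ε) :=
  ⟨hE, hε, mem_Emb_of_norm_eq (sub_self ε).ge fun _ => rfl⟩

/-- The spine `σ` always follows `s'`. For `m < n` the tooth `t (σ n)` refines `s' (σ m)`, the
incompatible sibling of the tooth `t (σ m)`, so no two teeth amalgamate. -/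
theorem guardedAmalgamation_of_omegaAmalgamation
    (hω : OmegaAmalgamationProperty (closure (Age X))) :
    GuardedAmalgamationProperty (closure (Age X)) := by
  refine guardedAmalgamationProperty_of_not_guardFails fun E hE ε hε hfail => ?_
  choose t s' hts hs's ht hs' htol hinc using fun s : {s // Admissible (closure (Age X)) E ε s} =>
    exists_incompatible_refinements hε hfail s.1 s.2
  let σ : ℕ → {s // Admissible (closure (Age X)) E ε s} := fun n =>
    Nat.rec ⟨_, admissible_idExtension hE hε⟩ (fun _ s => ⟨s' s, hs' s⟩) n
  have hσ : ∀ n, (σ (n + 1)).1.Refines (σ n).1 := fun n => hs's (σ n)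
  have key : ∀ m n, m < n → ∀ L ∈ closure (Age X), ∀ (g : (t (σ m)).space.Rep →ₗᵢ[ℝ] L.Rep)
      (g' : (t (σ n)).space.Rep →ₗᵢ[ℝ] L.Rep),
      ε / 4 ≤ ‖g.toContinuousLinearMap ∘L (t (σ m)).map
        - g'.toContinuousLinearMap ∘L (t (σ n)).map‖ := by
    intro m n hmn L hL g g'
    obtain ⟨h1, T, hT, hTm⟩ : (t (σ n)).Refines (s' (σ m)) :=
      (hts (σ n)).trans (Refines.of_succ (s := fun k => (σ k).1) hσ (Nat.succ_le_of_lt hmn))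
    have h0 := (ht (σ n)).2.1
    -- The first bound keeps the composites into `X` within tolerance. The second gives `‖a‖ ≤ 2`,
    -- so a gap of `ε / 2` in `X` comes from one of `ε / 4` in `L`.
    set κ := min (t (σ n)).tol (Real.log 2) with hκ
    have hκ0 : 0 < κ := lt_min h0 (Real.log_pos one_lt_two)
    have hκt : κ ≤ (t (σ n)).tol := min_le_left _ _
    obtain ⟨a, ha⟩ := mem_closure_Age_iff.1 hL κ hκ0
    have hj := comp_mem_Emb ha (isometry_mem_Emb le_rfl g)
    have hj' := comp_mem_Emb (comp_mem_Emb ha (isometry_mem_Emb le_rfl g')) hT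
    have hlt := hinc (σ m) _ (mem_Emb_mono (by linarith) hj) _ (mem_Emb_mono (by linarith) hj')
    have heq : (a ∘L g.toContinuousLinearMap) ∘L (t (σ m)).map
        - ((a ∘L g'.toContinuousLinearMap) ∘L T) ∘L (s' (σ m)).map
        = a ∘L (g.toContinuousLinearMap ∘L (t (σ m)).map
          - g'.toContinuousLinearMap ∘L (t (σ n)).map) := by
      rw [← hTm, ContinuousLinearMap.comp_sub]
      rfl
    rw [heq] at hlt
    have ha2 : ‖a‖ ≤ 2 := by
      refine (opNorm_le_of_mem_Emb ha).trans ?_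
      rw [← Real.le_log_iff_exp_le two_pos]
      exact min_le_right _ _
    have h2 := (ContinuousLinearMap.opNorm_comp_le a _).trans
      (mul_le_mul_of_nonneg_right ha2 (norm_nonneg (g.toContinuousLinearMap ∘L (t (σ m)).map
          - g'.toContinuousLinearMap ∘L (t (σ n)).map)))
    linarith
  obtain ⟨m, n, hmn, L, hL, g, g', hlt⟩ := hω E hE ε hε (ε / 4) (by positivity)
    (fun n => (t (σ n)).space) (fun n => (ht (σ n)).1) (fun n => (t (σ n)).map)
    (fun n => mem_Emb_mono (by linarith [(ht (σ n)).2.1]) (ht (σ n)).2.2)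
  rcases lt_or_gt_of_ne hmn with h | h
  · exact hlt.not_ge (key m n h L hL g g')
  · rw [norm_sub_rev] at hlt
    exact hlt.not_ge (key n m h L hL g' g)

/-- If `X` is relatively universal, then a sequence of successive refinements in
`closure (Age X)` has a limit that embeds into `X`. -/
theorem exists_common_map_of_refines [CompleteSpace X] (hX : RelativelyUniversal X)
    {E : Type*} [NormedAddCommGroup E] [NormedSpace ℝ E] {s : ℕ → Extension E}
    (hs : ∀ n, (s (n + 1)).Refines (s n)) (h0 : ∀ n, 0 < (s n).tol)
    (hK : ∀ n, (s n).space ∈ closure (Age X)) :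
    ∃ f : E →L[ℝ] X, ∀ n, ∃ j ∈ Emb (s n).tol (s n).space.Rep X, j ∘L (s n).map = f := by
  choose a ha using fun n => mem_closure_Age_iff.1 (hK n) (s n).tol (h0 n)
  -- The `T n m` need not be coherent with each other; only their agreement on the image of `E` is
  -- used.
  choose _ T hT hTm using fun n m (h : n ≤ m) => Refines.of_succ hs h
  -- The value `0` for `k < n` is harmless: for fixed `n` the hyperfilter ignores these finitely
  -- many `k`.
  let A : ∀ k n, (s n).space.Rep →ₗ[ℝ] X := fun k n =>
    if h : n ≤ k then (a k ∘L T n k h).toLinearMap else 0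
  have hA : ∀ n k x, n ≤ k → Real.exp (-(s n).tol) * ‖x‖ ≤ ‖A k n x‖ ∧
      ‖A k n x‖ ≤ Real.exp (s n).tol * ‖x‖ := by
    intro n k x h
    have := comp_mem_Emb (ha k) (hT n k h)
    rw [sub_add_cancel] at this
    simp only [A, dif_pos h]
    exact this x
  have hAm : ∀ n k e, n ≤ k → A k n ((s n).map e) = a k ((s k).map e) := by
    intro n k e h
    simp only [A, dif_pos h, ← hTm n k h]
    rfl
  let S : ℕ → (Π₀ n, (s n).space.Rep) →ₗ[ℝ] X := fun k => DFinsupp.lsum ℕ (A k)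
  have hSs : ∀ k n x, S k (DFinsupp.single n x) = A k n x := fun k n x =>
    DFinsupp.lsum_single ℕ (A k) n x
  have hSb : ∀ v, ∃ C, ∀ k, ‖S k v‖ ≤ C := by
    intro v
    induction v using DFinsupp.induction with
    | h0 => exact ⟨0, fun k => by simp⟩
    | ha n x v _ _ ih =>
      obtain ⟨C, hC⟩ := ih
      refine ⟨Real.exp (s n).tol * ‖x‖ + C, fun k => ?_⟩
      rw [map_add, hSs]
      refine (norm_add_le _ _).trans (add_le_add ?_ (hC k))
      by_cases h : n ≤ k
      · exact (hA n k x h).2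
      · simp only [A, dif_neg h, LinearMap.zero_apply, norm_zero]
        positivity
  choose b hb using fun n => Module.Finite.fg_top (R := ℝ) (M := (s n).space.Rep)
  have hspan : Submodule.span ℝ (⋃ n, DFinsupp.lsingle (R := ℝ)
      (M := fun n => (s n).space.Rep) n '' (b n : Set (s n).space.Rep)) = ⊤ := by
    rw [Submodule.span_iUnion, ← DFinsupp.iSup_range_lsingle]
    congr 1
    ext1 n
    rw [← Submodule.map_span, hb, Submodule.map_top]
  obtain ⟨Y, _, _, _, _, J, hfr, hJ⟩ := exists_limit_space S hSb
    (Set.countable_iUnion fun n => ((b n).countable_toSet.image _)) hspan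
  obtain ⟨i⟩ := hX Y hfr
  have hge : ∀ n, ∀ᶠ k in (hyperfilter ℕ : Filter ℕ), n ≤ k := fun n =>
    Nat.hyperfilter_le_atTop (eventually_ge_atTop n)
  let j : ∀ n, (s n).space.Rep →L[ℝ] X := fun n => LinearMap.toContinuousLinearMap
    (i.toLinearMap ∘ₗ J ∘ₗ DFinsupp.lsingle (R := ℝ) (M := fun n => (s n).space.Rep) n)
  have hj : ∀ n x, j n x = i (J (DFinsupp.single n x)) := fun n x => rfl
  refine ⟨j 0 ∘L (s 0).map, fun n => ⟨j n, fun x => ?_, ?_⟩⟩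
  · rw [hj, i.norm_map]
    constructor
    · refine ge_of_tendsto (hJ _) ((hge n).mono fun k hk => ?_)
      rw [hSs]
      exact (hA n k x hk).1
    · refine le_of_tendsto (hJ _) ((hge n).mono fun k hk => ?_)
      rw [hSs]
      exact (hA n k x hk).2
  · ext e
    change j n ((s n).map e) = j 0 ((s 0).map e)
    rw [hj, hj, ← sub_eq_zero, ← map_sub, ← map_sub, ← norm_eq_zero, i.norm_map]
    -- For `k ≥ n` the images of `e` from stages `n` and `0` coincide under `S k`, so the limit
    -- seminorm of their difference is zero.
    refine tendsto_nhds_unique (hJ _) (tendsto_const_nhds.congr' ((hge n).mono fun k hk => ?_))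
    beta_reduce
    rw [map_sub, hSs, hSs, hAm n k e hk, hAm 0 k e k.zero_le, sub_self, norm_zero]

/-- A diagonal argument: the limit of the branch induces an operator `E → X` that the construction
has kept away from every `f n`. -/
theorem guardedAmalgamation_of_relativelyUniversal [CompleteSpace X]
    [TopologicalSpace.SeparableSpace X] (hX : RelativelyUniversal X) :
    GuardedAmalgamationProperty (closure (Age X)) := by
  refine guardedAmalgamationProperty_of_not_guardFails fun E hE ε hε hfail => ?_
  have : SecondCountableTopology X := UniformSpace.secondCountable_of_separable X
  obtain ⟨f, hf⟩ := TopologicalSpace.exists_dense_seq (E.Rep →L[ℝ] X)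
  have hstep : ∀ (n : ℕ) (s : {s // Admissible (closure (Age X)) E ε s}),
      ∃ s' : {s // Admissible (closure (Age X)) E ε s}, s'.1.Refines s.1 ∧
        ∀ j ∈ Emb s'.1.tol s'.1.space.Rep X, ε / 4 ≤ ‖j ∘L s'.1.map - f n‖ := by
    intro n s
    obtain ⟨t, s', hts, hss, ht, hs', htol, hinc⟩ :=
      exists_incompatible_refinements hε hfail s.1 s.2
    -- The two sides are more than `ε / 2` apart in `X`, so if one comes within `ε / 4` of `f n`,
    -- the other never does.
    by_cases h : ∀ j ∈ Emb t.tol t.space.Rep X, ε / 4 ≤ ‖j ∘L t.map - f n‖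
    · exact ⟨⟨t, ht⟩, hts, h⟩
    · push Not at h
      obtain ⟨j, hj, hjf⟩ := h
      refine ⟨⟨s', hs'⟩, hss, fun j' hj' => ?_⟩
      have h1 := hinc j (htol ▸ hj) j' hj'
      have h2 := norm_sub_le_norm_sub_add_norm_sub (j ∘L t.map) (f n) (j' ∘L s'.map)
      rw [norm_sub_rev (f n)] at h2
      change ε / 4 ≤ ‖j' ∘L s'.map - f n‖
      linarith
  choose next hnext hfar using hstep
  let σ : ℕ → {s // Admissible (closure (Age X)) E ε s} := fun n =>
    Nat.rec ⟨_, admissible_idExtension hE hε⟩ (fun n s => next n s) n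
  obtain ⟨g, hg⟩ := exists_common_map_of_refines hX (s := fun n => (σ n).1)
    (fun n => hnext n (σ n)) (fun n => (σ n).2.2.1) fun n => (σ n).2.1
  obtain ⟨n, hn⟩ := hf.exists_dist_lt g (by positivity : 0 < ε / 4)
  -- It is stage `n + 1` that was chosen to avoid `f n`.
  obtain ⟨j, hj, hjg⟩ := hg (n + 1)
  have := hfar n (σ n) j hj
  rw [dist_eq_norm] at hn
  change ε / 4 ≤ ‖j ∘L (σ (n + 1)).1.map - f n‖ at this
  rw [hjg] at this
  linarith

end Chains

end GuardedFraisse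

end

theorem mainTheorem12 {X : Type*} [NormedAddCommGroup X] [NormedSpace ℝ X] [CompleteSpace X]
    [TopologicalSpace.SeparableSpace X]
    (h : GuardedFraisse.OmegaAmalgamationProperty (closure (GuardedFraisse.Age X)) ∨
      GuardedFraisse.RelativelyUniversal X) :
    GuardedFraisse.IsGuardedFraisseClass (closure (GuardedFraisse.Age X)) where
  nonempty := GuardedFraisse.nonempty_closure_Age
  isClosed := isClosed_closure
  hereditary := GuardedFraisse.hereditary_closure_Age
  jointEmbedding := GuardedFraisse.jointEmbedding_closure_Age
  guardedAmalgamation := h.elim GuardedFraisse.guardedAmalgamation_of_omegaAmalgamation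
    GuardedFraisse.guardedAmalgamation_of_relativelyUniversal
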